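/- Let $K$ be a field of characteristic zero and $n\ge 0$ an integer. Let $N=\mathrm{UT}(n,K)$ be the group of lower triangular $n\times n$ matrices over $K$ with ones on the diagonal, let $\mathfrak n=\mathfrak{ut}(n,K)$ be its Lie algebra of lower triangular matrices with zeros on the diagonal, and let $\{y_{ij}\}_{1\le j<i\le n}$ be the standard basis of $\mathfrak n$ ($y_{ij}$ is the matrix unit with entry $1$ in row $i$ and column $j$). The group $N$ acts on the dual space $\mathfrak n^*$ by $(\mathrm{Ad}^*_g f)(x)=f(g^{-1}xg)$; write $\Omega(f)=\{\mathrm{Ad}^*_g f : g\in N\}$ for the coadjoint orbit of $f\in\mathfrak n^*$. Let $\sigma\in S_n$ satisfy $\sigma^2=\mathrm{id}$, and write $\sigma$ as a product of pairwise commuting distinct transpositions $(j_1\,i_1)\cdots(j_s\,i_s)$ with $j_m<i_m$ (this decomposition is unique up to order; $s=0$ if $\sigma=\mathrm{id}$). Let $X_\sigma\subset\mathfrak n^*$ be the set of all $f$ with $f(y_{i_m j_m})\neq 0$ for $1\le m\le s$ and $f(y_{ij})=0$ for all other standard basis vectors $y_{ij}$. Then for every $f\in X_\sigma$ one has $\Omega(f)\cap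 X_\sigma=\{f\}$. Consequently $X_\sigma$ is a cross-section of the family of orbits $\{\Omega(f) : f\in X_\sigma\}$: every orbit of this family contains exactly one element of $X_\sigma$. -/

import Mathlib

open Matrix

attribute [local instance] LieRing.ofAssociativeRing

/-- The unitriangular group `UT(n, K)`: lower triangular matrices with ones on the diagonal,
as a subgroup of `GL(n, K)`. -/
def UT (n : ℕ) (K : Type*) [Field K] : Subgroup (GL (Fin n) K) where
  carrier := {g | (∀ i j, i < j → g.1 i j = 0) ∧ ∀ i, g.1 i i = 1}
  one_mem' := by
    refine ⟨fun i j h => ?_, fun i => ?_⟩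
    · simp [Matrix.one_apply_ne h.ne]
    · simp
  mul_mem' := by
    rintro a b ⟨ha, ha1⟩ ⟨hb, hb1⟩
    refine ⟨fun i j h => ?_, fun i => ?_⟩
    · simp only [Units.val_mul, Matrix.mul_apply]
      refine Finset.sum_eq_zero fun k _ => ?_
      rcases lt_or_ge i k with hk | hk
      · simp [ha i k hk]
      · simp [hb k j (hk.trans_lt h)]
    · simp only [Units.val_mul, Matrix.mul_apply]
      rw [Finset.sum_eq_single i]
      · simp [ha1, hb1]
      · intro k _ hk
        rcases lt_or_gt_of_ne hk with hk | hk
        · simp [hb k i hk]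
        · simp [ha i k hk]
      · simp
  inv_mem' := by
    rintro a ⟨ha, ha1⟩
    have ht : BlockTriangular a.1 OrderDual.toDual := fun i j h => ha i j h
    have hi : ∀ i j, i < j → a⁻¹.1 i j = 0 := by
      have : BlockTriangular (a.1)⁻¹ OrderDual.toDual := by
        have : Invertible a.1 := a.invertible
        exact blockTriangular_inv_of_blockTriangular ht
      intro i j h
      rw [Matrix.coe_units_inv]
      exact this h
    refine ⟨hi, fun i => ?_⟩
    have h1 : (a⁻¹.1 * a.1) i i = 1 := by simp
    rw [Matrix.mul_apply, Finset.sum_eq_single i] at h1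
    · simpa [ha1] using h1
    · intro k _ hk
      rcases lt_or_gt_of_ne hk with hk | hk
      · simp [ha k i hk]
      · simp [hi i k hk]
    · simp

/-- The Lie algebra `𝔲𝔱(n, K)`: lower triangular matrices with zeros on the diagonal,
with the commutator bracket. -/
def ut (n : ℕ) (K : Type*) [Field K] : LieSubalgebra K (Matrix (Fin n) (Fin n) K) where
  carrier := {x | ∀ i j, i ≤ j → x i j = 0}
  zero_mem' := by intro i j _; rfl
  add_mem' := by
    intro a b ha hb i j h
    simp [ha i j h, hb i j h]
  smul_mem' := by
    intro c a ha i j h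
    simp [ha i j h]
  lie_mem' := by
    have key : ∀ a b : Matrix (Fin n) (Fin n) K, (∀ i j, i ≤ j → a i j = 0) →
        (∀ i j, i ≤ j → b i j = 0) → ∀ i j, i ≤ j → (a * b) i j = 0 := by
      intro a b ha hb i j h
      rw [Matrix.mul_apply]
      refine Finset.sum_eq_zero fun k _ => ?_
      rcases le_or_gt i k with hk | hk
      · simp [ha i k hk]
      · simp [hb k j (hk.le.trans h)]
    intro a b ha hb i j h
    rw [Ring.lie_def, Matrix.sub_apply, key a b ha hb i j h, key b a hb ha i j h, sub_zero]

/-- `𝔲𝔱(n, K)` is stable under conjugation by `UT(n, K)`. -/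
theorem conj_mem_ut {n : ℕ} {K : Type*} [Field K] (g : UT n K) (x : ut n K) :
    g.1.1 * x.1 * (g.1⁻¹).1 ∈ ut n K := by
  obtain ⟨hg, -⟩ := g.2
  obtain ⟨hi, -⟩ := (UT n K).inv_mem g.2
  have hx : ∀ i j, i ≤ j → x.1 i j = 0 := x.2
  intro i j h
  rw [Matrix.mul_apply]
  refine Finset.sum_eq_zero fun k _ => ?_
  rcases lt_or_ge k j with hk | hk
  · rw [hi k j hk, mul_zero]
  · have : (g.1.1 * x.1) i k = 0 := by
      rw [Matrix.mul_apply]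
      refine Finset.sum_eq_zero fun l _ => ?_
      rcases lt_or_ge i l with hl | hl
      · rw [hg i l hl, zero_mul]
      · rw [hx l k (hl.trans (h.trans hk)), mul_zero]
    rw [this, zero_mul]

/-- The adjoint representation `Ad g x = g x g⁻¹` of `UT(n, K)` on `𝔲𝔱(n, K)`. -/
def adjointRep (n : ℕ) (K : Type*) [Field K] : Representation K (UT n K) (ut n K) where
  toFun g :=
    { toFun := fun x => ⟨g.1.1 * x.1 * (g.1⁻¹).1, conj_mem_ut g x⟩
      map_add' := fun x y => Subtype.ext (by simp [mul_add, add_mul])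
      map_smul' := fun c x => Subtype.ext (by simp) }
  map_one' := LinearMap.ext fun x => Subtype.ext (by simp)
  map_mul' g h := LinearMap.ext fun x => Subtype.ext (by simp [mul_assoc])

/-- The coadjoint representation on `𝔲𝔱(n, K)*`: `(Ad* g f)(x) = f (Ad g⁻¹ x)`. -/
def coadjointRep (n : ℕ) (K : Type*) [Field K] :
    Representation K (UT n K) (Module.Dual K (ut n K)) :=
  (adjointRep n K).dual

theorem coadjointRep_apply {n : ℕ} {K : Type*} [Field K] (g : UT n K)
    (f : Module.Dual K (ut n K)) (x : ut n K) :
    coadjointRep n K g f x = f (adjointRep n K g⁻¹ x) := rfl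

/-- The coadjoint orbit `Ω(f)`. -/
def coadjointOrbit {n : ℕ} {K : Type*} [Field K] (f : Module.Dual K (ut n K)) :
    Set (Module.Dual K (ut n K)) :=
  Set.range fun g : UT n K => coadjointRep n K g f

/-- The standard basis vector `y_{ij}` of `𝔲𝔱(n, K)`, for `j < i`: the matrix unit with its
entry `1` in row `i` and column `j`. -/
def yBasis {n : ℕ} (K : Type*) [Field K] (i j : Fin n) (h : j < i) : ut n K :=
  ⟨Matrix.single i j 1, by
    intro a b hab
    refine Matrix.single_apply_of_ne _ _ _ _ _ ?_
    rintro ⟨rfl, rfl⟩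
    exact absurd h (not_lt.mpr hab)⟩

/-- The set of positive roots `ε_j - ε_i`, `j < i`, coded by the pairs `(j, i)`, whose reflections
(transpositions `(j i)`) are the factors of the decomposition of the involution `σ` into a product
of commuting reflections; these are the transpositions `(j i)` with `σ j = i`. -/
def rootSet {n : ℕ} (σ : Equiv.Perm (Fin n)) : Set (Fin n × Fin n) :=
  {p | p.1 < p.2 ∧ σ p.1 = p.2}

/-- For an involution `σ`, the reflections of the roots in `rootSet σ` are exactly the factors in
the decomposition of `σ` into disjoint cycles. -/
theorem mem_rootSet_iff {n : ℕ} {σ : Equiv.Perm (Fin n)} (hσ : σ ^ 2 = 1) (j i : Fin n) :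
    (j, i) ∈ rootSet σ ↔ j < i ∧ Equiv.swap j i ∈ σ.cycleFactorsFinset := by
  have h2 : ∀ k, σ (σ k) = k := fun k => by
    simpa [pow_two] using congrArg (fun τ : Equiv.Perm (Fin n) => τ k) hσ
  refine and_congr_right fun h => ?_
  have h' : j < i := h
  rw [Equiv.Perm.mem_cycleFactorsFinset_iff]
  constructor
  · intro hji
    have hji : σ j = i := hji
    refine ⟨Equiv.Perm.isCycle_swap h'.ne, fun a ha => ?_⟩
    rw [Equiv.Perm.support_swap h'.ne, Finset.mem_insert, Finset.mem_singleton] at ha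
    rcases ha with rfl | rfl
    · rw [Equiv.swap_apply_left, hji]
    · rw [Equiv.swap_apply_right, ← hji, h2]
  · rintro ⟨-, ha⟩
    have := ha j (by rw [Equiv.Perm.support_swap h'.ne]; simp)
    rw [Equiv.swap_apply_left] at this
    exact this.symm

/-- `X_σ`: the linear forms on `𝔲𝔱(n, K)` that are nonzero on `y_{ij}` when `ε_j - ε_i` is a root
of the decomposition of `σ`, and vanish on all other standard basis vectors. -/
def XSet {n : ℕ} (K : Type*) [Field K] (σ : Equiv.Perm (Fin n)) :
    Set (Module.Dual K (ut n K)) :=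
  {f | ∀ (i j : Fin n) (h : j < i),
    ((j, i) ∈ rootSet σ → f (yBasis K i j h) ≠ 0) ∧
    ((j, i) ∉ rootSet σ → f (yBasis K i j h) = 0)}

/-!
Let `f' = Ad*_g f` with `f, f' ∈ X_σ`. For `y ∈ 𝔲𝔱(n, K)` the products `g y` and `y g` are again
strictly lower triangular, and since `Ad g⁻¹ (g y) = y g`, one has `f' (g y) = f (y g)`
(`coadjointRep_apply_mul_left`).

Take `y = y_{ij}` with `σ j = i`. The product `y_{ij} g` is supported on row `i`, and `y_{ij}` is the
only basis vector in that row on which a form in `X_σ` can be nonzero, because `σ` is injective; so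
`f (y_{ij} g) = g_{jj} f (y_{ij}) = f (y_{ij})`. Likewise `g y_{ij}` is supported on column `j`, and
`f' (g y_{ij}) = g_{ii} f' (y_{ij}) = f' (y_{ij})`. Hence `f` and `f'` agree on all basis vectors.
-/

/-- Expansion of a linear form on `𝔲𝔱(n, K)` in the standard basis. -/
theorem dual_apply_eq_sum {n : ℕ} {K : Type*} [Field K] (f : Module.Dual K (ut n K)) (x : ut n K) :
    f x = ∑ i, ∑ j, if h : j < i then x.1 i j * f (yBasis K i j h) else 0 := by
  have hx : x = ∑ i, ∑ j, if h : j < i then x.1 i j • yBasis K i j h else 0 := by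
    apply Subtype.ext
    conv_lhs => rw [Matrix.matrix_eq_sum_single x.1]
    simp only [AddSubmonoidClass.coe_finsetSum]
    refine Finset.sum_congr rfl fun i _ => Finset.sum_congr rfl fun j _ => ?_
    split_ifs with h
    · simp [yBasis]
    · rw [x.2 i j (not_lt.mp h), Matrix.single_zero]
      rfl
  conv_lhs => rw [hx]
  simp only [map_sum]
  refine Finset.sum_congr rfl fun i _ => Finset.sum_congr rfl fun j _ => ?_
  split_ifs <;> simp

theorem dual_ext_yBasis {n : ℕ} {K : Type*} [Field K] {f f' : Module.Dual K (ut n K)}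
    (h : ∀ (i j : Fin n) (hji : j < i), f (yBasis K i j hji) = f' (yBasis K i j hji)) : f = f' := by
  refine LinearMap.ext fun x => ?_
  rw [dual_apply_eq_sum f, dual_apply_eq_sum f']
  simp only [h]

theorem UT_mul_mem_ut {n : ℕ} {K : Type*} [Field K] (g : UT n K) (x : ut n K) :
    g.1.1 * x.1 ∈ ut n K := by
  intro i j h
  rw [Matrix.mul_apply]
  refine Finset.sum_eq_zero fun k _ => ?_
  rcases lt_or_ge i k with hk | hk
  · rw [g.2.1 i k hk, zero_mul]
  · rw [x.2 k j (hk.trans h), mul_zero]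

theorem mul_UT_mem_ut {n : ℕ} {K : Type*} [Field K] (g : UT n K) (x : ut n K) :
    x.1 * g.1.1 ∈ ut n K := by
  intro i j h
  rw [Matrix.mul_apply]
  refine Finset.sum_eq_zero fun k _ => ?_
  rcases lt_or_ge k j with hk | hk
  · rw [g.2.1 k j hk, mul_zero]
  · rw [x.2 i k (h.trans hk), zero_mul]

theorem coadjointRep_apply_mul_left {n : ℕ} {K : Type*} [Field K] (g : UT n K)
    (f : Module.Dual K (ut n K)) (x : ut n K) :
    coadjointRep n K g f ⟨g.1.1 * x.1, UT_mul_mem_ut g x⟩ =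
      f ⟨x.1 * g.1.1, mul_UT_mem_ut g x⟩ := by
  rw [coadjointRep_apply]
  congr 1
  apply Subtype.ext
  change (g⁻¹).1.1 * (g.1.1 * x.1) * ((g⁻¹).1⁻¹).1 = x.1 * g.1.1
  simp [← mul_assoc]

/-- On a matrix whose only nonzero row is row `i = σ j`, a form in `X_σ` sees only the
`(i, j)` entry. -/
theorem XSet_apply_of_row {n : ℕ} {K : Type*} [Field K] {σ : Equiv.Perm (Fin n)}
    {f : Module.Dual K (ut n K)} (hf : f ∈ XSet K σ) {i j : Fin n} (hji : j < i) (hσ : σ j = i)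
    (x : ut n K) (hx : ∀ k l, k ≠ i → x.1 k l = 0) :
    f x = x.1 i j * f (yBasis K i j hji) := by
  rw [dual_apply_eq_sum, Finset.sum_eq_single i, Finset.sum_eq_single j, dif_pos hji]
  · intro l _ hl
    split_ifs with h
    · rw [(hf i l h).2 fun hr => hl (σ.injective (hr.2.trans hσ.symm)), mul_zero]
    · rfl
  · simp
  · intro k _ hk
    refine Finset.sum_eq_zero fun l _ => ?_
    simp [hx k l hk]
  · simp

/-- On a matrix whose only nonzero column is column `j`, a form in `X_σ` sees only the
`(σ j, j)` entry. -/
theorem XSet_apply_of_col {n : ℕ} {K : Type*} [Field K] {σ : Equiv.Perm (Fin n)}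
    {f : Module.Dual K (ut n K)} (hf : f ∈ XSet K σ) {i j : Fin n} (hji : j < i) (hσ : σ j = i)
    (x : ut n K) (hx : ∀ k l, l ≠ j → x.1 k l = 0) :
    f x = x.1 i j * f (yBasis K i j hji) := by
  rw [dual_apply_eq_sum, Finset.sum_eq_single i, Finset.sum_eq_single j, dif_pos hji]
  · intro l _ hl
    simp [hx i l hl]
  · simp
  · intro k _ hk
    refine Finset.sum_eq_zero fun l _ => ?_
    split_ifs with h
    · by_cases hl : l = j
      · subst hl
        rw [(hf k l h).2 fun hr => hk (hr.2.symm.trans hσ), mul_zero]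
      · rw [hx k l hl, zero_mul]
    · rfl
  · simp

theorem coadjointRep_eq_self_of_mem_XSet {n : ℕ} {K : Type*} [Field K] {σ : Equiv.Perm (Fin n)}
    {f : Module.Dual K (ut n K)} (hf : f ∈ XSet K σ) (g : UT n K)
    (hg : coadjointRep n K g f ∈ XSet K σ) : coadjointRep n K g f = f := by
  refine dual_ext_yBasis fun i j hji => ?_
  by_cases hr : (j, i) ∈ rootSet σ
  · have hσ : σ j = i := hr.2
    have key := coadjointRep_apply_mul_left g f (yBasis K i j hji)
    rw [XSet_apply_of_col hg hji hσ _ fun k l hl =>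
      Matrix.mul_single_apply_of_ne _ _ _ _ _ hl _,
      XSet_apply_of_row hf hji hσ _ fun k l hk =>
      Matrix.single_mul_apply_of_ne _ _ _ _ _ hk _] at key
    simpa [yBasis, g.2.2 i, g.2.2 j] using key
  · rw [(hg i j hji).2 hr, (hf i j hji).2 hr]

theorem corollary1p5 (n : ℕ) (K : Type*) [Field K] [CharZero K]
    (σ : Equiv.Perm (Fin n)) (hσ : σ ^ 2 = 1) :
    (∀ f ∈ XSet K σ, coadjointOrbit f ∩ XSet K σ = {f}) ∧
    (∀ O ∈ {O : Set (Module.Dual K (ut n K)) | ∃ f ∈ XSet K σ, O = coadjointOrbit f},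
      ∃! g, g ∈ O ∩ XSet K σ) := by
  have orbit_inter : ∀ f ∈ XSet K σ, coadjointOrbit f ∩ XSet K σ = {f} := by
    intro f hf
    refine Set.Subset.antisymm ?_ ?_
    · rintro _ ⟨⟨g, rfl⟩, hg⟩
      exact coadjointRep_eq_self_of_mem_XSet hf g hg
    · rintro _ rfl
      exact ⟨⟨1, by simp⟩, hf⟩
  refine ⟨orbit_inter, ?_⟩
  rintro _ ⟨f, hf, rfl⟩
  rw [orbit_inter f hf]
  exact ⟨f, rfl, fun _ h => h⟩
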